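/- Let $\mathcal{X}=\{1,2,\dots\}$. For each $n\ge 1$ let $(X_n,Y_n)$ be a pair of random variables defined on some probability space (which may depend on $n$), where $X_n$ takes values in $\mathcal{X}$ and $Y_n$ takes values in a nonempty measurable space $\mathcal{Y}_n$ (for instance a standard Borel space), and let $L_n\ge 1$ be an integer. Write $P_{X_n}$ for the distribution of $X_n$ and $P_{X_n|Y_n}$ for the regular conditional distribution of $X_n$ given $Y_n$. For a probability distribution $P$ on $\mathcal{X}$ let $H(P)=\sum_{x\in\mathcal{X}}P(x)\log\frac{1}{P(x)}\in[0,\infty]$ (with $0\log\frac10=0$), and put $H(X_n)=H(P_{X_n})$ and $H(X_n\mid Y_n)=\mathbb{E}[H(P_{X_n|Y_n})]$. Let $$P_{\mathrm e}^{(L)}(X\mid Y)=\min_{f}\mathbb{P}\{X\notin f(Y)\},$$ where $f$ ranges over all measurable maps from the range space of $Y$ to the set of nonempty subsets of $\mathcal{X}$ with at most $L$ elements. Write $|u|^+=\max\{0,u\}$. Suppose that $\{X_n\}_{n\ge1}$ satisfies the asymptotic equipartition property $$\lim_{n\to\infty}\mathbb{P}\Big\{\log\frac{1}{P_{X_n}(X_n)}\le(1-\delta)\,H(X_n)\Big\}=0\qquad\text{for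 every fixed }\delta>0,$$ and that $H(X_n)=\Omega(1)$, i.e. there is a constant $c>0$ with $H(X_n)\ge c$ for all sufficiently large $n$. Then $$P_{\mathrm e}^{(L_n)}(X_n\mid Y_n)=\mathrm{o}(1)\ \Longrightarrow\ \big|H(X_n\mid Y_n)-\log L_n\big|^+=\mathrm{o}\big(H(X_n)\big).$$ Consequently, $$P_{\mathrm e}^{(L_n)}(X_n\mid Y_n)=\mathrm{o}(1)\ \text{ and }\ \log L_n=\mathrm{o}\big(H(X_n)\big)\ \Longrightarrow\ H(X_n\mid Y_n)=\mathrm{o}\big(H(X_n)\big).$$ -/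

import Mathlib

open MeasureTheory ProbabilityTheory Filter Topology
open scoped ENNReal NNReal

noncomputable section

namespace ListFano

/-- The alphabet `{1, 2, …}` carries the discrete σ-algebra. -/
instance instMeasurableSpacePNat : MeasurableSpace ℕ+ := ⊤

instance instDiscreteMeasurableSpacePNat : DiscreteMeasurableSpace ℕ+ := ⟨fun _ => trivial⟩

/-- The Shannon entropy `H(p) = ∑ₓ p(x) log (1 / p(x)) ∈ [0, ∞]` of a distribution `p` on the
countably infinite alphabet `{1, 2, …}` (natural logarithm, `0 log (1 / 0) = 0`).
Here `Real.negMulLog t = - t * log t`, which is nonnegative on `[0, 1]`. -/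
def entropy (p : Measure ℕ+) : ℝ≥0∞ :=
  ∑' x : ℕ+, ENNReal.ofReal (Real.negMulLog (p.real {x}))

section RandomVariables

variable {Ω : Type*} [MeasurableSpace Ω] {𝒴 : Type*} [MeasurableSpace 𝒴]

/-- The Shannon entropy `H(X) ∈ [0, ∞]` of a random variable `X` on `(Ω, P)`: the entropy of its
law. -/
def rvEntropy (P : Measure Ω) (X : Ω → ℕ+) : ℝ≥0∞ :=
  entropy (P.map X)

/-- The conditional Shannon entropy (equivocation) `H(X | Y) = 𝔼[H(P_{X|Y})] ∈ [0, ∞]`, where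
`P_{X|Y}` is the regular conditional distribution of `X` given `Y`. -/
def condEntropy (P : Measure Ω) [IsFiniteMeasure P] (X : Ω → ℕ+) (Y : Ω → 𝒴) : ℝ≥0∞ :=
  ∫⁻ ω, entropy (condDistrib X Y P (Y ω)) ∂P

/-- A list decoder with list size `L`: it sends each `y` to a nonempty set of at most `L`
candidates. The second clause is measurability of `f` for the discrete σ-algebra on the
(countable) set of finite subsets of `{1, 2, …}`; it makes `{X ∉ f(Y)}` an event. -/
def IsListDecoder (L : ℕ) (f : 𝒴 → Finset ℕ+) : Prop :=
  (∀ y, (f y).Nonempty ∧ (f y).card ≤ L) ∧ ∀ x : ℕ+, MeasurableSet {y | x ∈ f y}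

/-- The minimum average probability of list decoding error
`P_e^{(L)}(X | Y) = min_f ℙ{X ∉ f(Y)}`, over all list decoders `f` with list size `L`. -/
def listError (P : Measure Ω) (L : ℕ) (X : Ω → ℕ+) (Y : Ω → 𝒴) : ℝ≥0∞ :=
  ⨅ (f : 𝒴 → Finset ℕ+) (_ : IsListDecoder L f), P {ω | X ω ∉ f (Y ω)}

end RandomVariables

/-- The asymptotic equipartition property of a general source `(X n)`: for every `δ > 0`,
`ℙ{log (1 / P_{X n}(X n)) ≤ (1 - δ) H(X n)} → 0`. Both sides of the inequality are extended
reals, so that no finiteness of the entropy is presupposed. -/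
def SatisfiesAEP {Ω : ℕ → Type*} [∀ n, MeasurableSpace (Ω n)]
    (P : ∀ n, Measure (Ω n)) (X : ∀ n, Ω n → ℕ+) : Prop :=
  ∀ δ : ℝ, 0 < δ →
    Tendsto
      (fun n => P n {ω | ENNReal.log (1 / (P n).map (X n) {X n ω}) ≤
        ((1 - δ : ℝ) : EReal) * (rvEntropy (P n) (X n) : EReal)})
      atTop (𝓝 0)

/-- `a n = o(b n)` for sequences in `[0, ∞]`: for every real `c > 0`, eventually
`a n ≤ c * b n`. -/
def IsLittleOh (a b : ℕ → ℝ≥0∞) : Prop :=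
  ∀ c : ℝ≥0, 0 < c → ∀ᶠ n in atTop, a n ≤ c * b n

/-- `b n = Ω(1)` for a sequence in `[0, ∞]`: it is eventually bounded below by a constant
`c > 0`. -/
def IsOmegaOne (b : ℕ → ℝ≥0∞) : Prop :=
  ∃ c : ℝ≥0, 0 < c ∧ ∀ᶠ n in atTop, (c : ℝ≥0∞) ≤ b n

end ListFano

end

/-!
By Gibbs' inequality the entropy of `P_{X|Y=y}` is at most its mean information content relative to
any subprobability measure, and we take the mixture of `1 - η` times the uniform weight `1 / L` on
the list `f(y)` and `η` times the law of `X`. A correctly decoded symbol then costs at most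
`log L + log (1 / (1 - η))`, and any other symbol at most `log (1 / η) + log (1 / P_X(X))`.
Averaging over `(X, Y)`, the excess of `H(X | Y)` over `log L` is at most
`log (1 / (1 - η)) + log (1 / η) P(E) + 𝔼[log (1 / P_X(X)); E]` for the error event `E`.

The last term is where the equipartition property enters: `log (1 / P_X(X))` has mean `H(X)` and
exceeds `(1 - δ) H(X)` with probability close to `1`, so the complement of `E` already carries
almost all of the mean, and only a small fraction of `H(X)` is left for `E`. Since `H(X)` is bounded
below, the first term is small relative to `H(X)` once `η` is small, and the second one is small
because `P(E) → 0` for fixed `η`.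
-/

namespace ListFano

section SetLIntegral

variable {Ω : Type*} [MeasurableSpace Ω] {P : Measure Ω} [IsProbabilityMeasure P]

theorem setLIntegral_le_add_measure_mul_lintegral {g : Ω → ℝ≥0∞} (hg : AEMeasurable g P)
    (δ : ℝ≥0∞) {E : Set Ω} (hE : MeasurableSet E) :
    ∫⁻ ω in E, g ω ∂P ≤
      (δ + (P E + P {ω | g ω ≤ (1 - δ) * ∫⁻ ω, g ω ∂P})) * ∫⁻ ω, g ω ∂P := by
  set H := ∫⁻ ω, g ω ∂P
  set t := (1 - δ) * H
  set B := {ω | g ω ≤ t}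
  rcases eq_or_ne H ⊤ with hH | hH
  · rcases eq_or_ne (P E) 0 with hPE | hPE
    · simp [Measure.restrict_eq_zero.2 hPE]
    · simp [hH, hPE]
  have ht : t ≤ H := mul_le_of_le_one_left' tsub_le_self
  have hmarkov : t * P (Eᶜ ∩ Bᶜ) ≤ ∫⁻ ω in Eᶜ, g ω ∂P :=
    calc t * P (Eᶜ ∩ Bᶜ) ≤ t * P.restrict Eᶜ {ω | t ≤ g ω} := by
          gcongr t * ?_
          rw [Set.inter_comm]
          refine (Measure.le_restrict_apply Eᶜ Bᶜ).trans (measure_mono fun ω hω => ?_)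
          exact (not_le.1 (by simpa [B] using hω)).le
      _ ≤ ∫⁻ ω in Eᶜ, g ω ∂P := mul_meas_ge_le_lintegral₀ hg.restrict t
  have hcover : 1 ≤ P (Eᶜ ∩ Bᶜ) + (P E + P B) :=
    calc 1 = P ((Eᶜ ∩ Bᶜ) ∪ (E ∪ B)) := by
          rw [← Set.compl_union, Set.compl_union_self, measure_univ]
      _ ≤ P (Eᶜ ∩ Bᶜ) + (P E + P B) :=
          (measure_union_le _ _).trans (by gcongr; exact measure_union_le _ _)
  refine (ENNReal.add_le_add_iff_right (ne_top_of_le_ne_top hH ht)).1 ?_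
  calc ∫⁻ ω in E, g ω ∂P + t
      ≤ ∫⁻ ω in E, g ω ∂P + t * (P (Eᶜ ∩ Bᶜ) + (P E + P B)) := by
        gcongr
        exact le_mul_of_one_le_right' hcover
    _ ≤ (∫⁻ ω in E, g ω ∂P + ∫⁻ ω in Eᶜ, g ω ∂P) + H * (P E + P B) := by
        rw [mul_add, ← add_assoc]
        gcongr
    _ = 1 * H + (P E + P B) * H := by rw [lintegral_add_compl _ hE, one_mul, mul_comm H]
    _ ≤ (δ + (1 - δ)) * H + (P E + P B) * H := by gcongr; exact le_add_tsub
    _ = (δ + (P E + P B)) * H + t := by ring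

end SetLIntegral

/-- The information content `log (1 / a) ∈ [0, ∞]` of an event of probability `a`. It is `∞` at
`a = 0`, and it is cut off at `0` for `a > 1`. -/
noncomputable def infoContent (a : ℝ≥0∞) : ℝ≥0∞ :=
  (ENNReal.log a⁻¹).toENNReal

section InfoContent

variable {a b : ℝ≥0∞}

@[simp]
theorem infoContent_zero : infoContent 0 = ⊤ := by
  simp [infoContent]

@[simp]
theorem infoContent_one : infoContent 1 = 0 := by
  simp [infoContent]

theorem infoContent_eq_top_iff : infoContent a = ⊤ ↔ a = 0 := by
  simp [infoContent]

theorem infoContent_eq_zero_iff : infoContent a = 0 ↔ 1 ≤ a := by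
  simp [infoContent, EReal.toENNReal_eq_zero_iff]

theorem infoContent_of_ne_zero_of_ne_top (ha : a ≠ 0) (ha' : a ≠ ⊤) :
    infoContent a = ENNReal.ofReal (-Real.log a.toReal) := by
  rw [infoContent, ENNReal.log_inv, ENNReal.log_pos_real ha ha', ← EReal.coe_neg,
    EReal.real_coe_toENNReal]

theorem infoContent_inv_natCast (n : ℕ) :
    infoContent (n : ℝ≥0∞)⁻¹ = ENNReal.ofReal (Real.log n) := by
  rcases eq_or_ne n 0 with rfl | hn
  · simp [infoContent]
  · rw [infoContent_of_ne_zero_of_ne_top (by simp) (by simpa using hn)]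
    simp

theorem coe_infoContent (ha : a ≤ 1) : (infoContent a : EReal) = ENNReal.log (1 / a) := by
  rw [infoContent, EReal.coe_toENNReal (by simpa using ha), one_div]

theorem continuous_infoContent : Continuous infoContent :=
  EReal.continuous_toENNReal.comp (ENNReal.continuous_log.comp continuous_inv)

theorem antitone_infoContent : Antitone infoContent := fun _ _ h =>
  EReal.toENNReal_le_toENNReal (ENNReal.log_le_log (ENNReal.inv_le_inv.2 h))

theorem infoContent_mul_le : infoContent (a * b) ≤ infoContent a + infoContent b := by
  rcases eq_or_ne a 0 with rfl | ha
  · simp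
  rcases eq_or_ne b 0 with rfl | hb
  · simp
  rw [infoContent, ENNReal.mul_inv (.inl ha) (.inr hb), ENNReal.log_mul_add]
  exact EReal.toENNReal_add_le

theorem exists_infoContent_one_sub_lt {c : ℝ≥0∞} (hc : c ≠ 0) :
    ∃ η : ℝ≥0∞, 0 < η ∧ η < 1 ∧ infoContent (1 - η) < c := by
  have hlim : Tendsto (fun η : ℝ≥0∞ => infoContent (1 - η)) (𝓝[>] 0) (𝓝 0) := by
    have := (continuous_infoContent.comp (ENNReal.continuous_sub_left ENNReal.one_ne_top)).tendsto 0
    simpa [Function.comp_def] using this.mono_left nhdsWithin_le_nhds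
  obtain ⟨η, hηc, hη⟩ := ((hlim.eventually_lt_const hc.bot_lt).and
    (Ioo_mem_nhdsGT one_pos)).exists
  exact ⟨η, hη.1, hη.2, hηc⟩

end InfoContent

section Gibbs

theorem negMulLog_le_neg_mul_log_add_sub {q r : ℝ} (hq : 0 ≤ q) (hr : 0 < r) :
    Real.negMulLog q ≤ q * -Real.log r + (r - q) := by
  have h := mul_le_mul_of_nonneg_left
    (Real.negMulLog_le_one_sub_self (div_nonneg hq hr.le)) hr.le
  have hmul := Real.negMulLog_mul r (q / r)
  rw [mul_div_cancel₀ q hr.ne'] at hmul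
  calc Real.negMulLog q = q / r * Real.negMulLog r + r * Real.negMulLog (q / r) := hmul
    _ ≤ q / r * Real.negMulLog r + r * (1 - q / r) := by gcongr
    _ = q * -Real.log r + (r - q) := by rw [Real.negMulLog]; field_simp

theorem ofReal_negMulLog_add_le {q r : ℝ≥0∞} (hq : q ≤ 1) :
    ENNReal.ofReal (Real.negMulLog q.toReal) + q ≤ q * infoContent r + r := by
  rcases eq_or_ne q 0 with rfl | hq0
  · simp
  rcases eq_or_ne r 0 with rfl | hr0
  · simp [hq0]
  rcases eq_or_ne r ⊤ with rfl | hr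
  · simp
  have hqt : q ≠ ⊤ := ne_top_of_le_ne_top ENNReal.one_ne_top hq
  have hq1 : q.toReal ≤ 1 := ENNReal.toReal_le_of_le_ofReal zero_le_one (by simpa using hq)
  rw [infoContent_of_ne_zero_of_ne_top hr0 hr]
  nth_rw 2 3 [← ENNReal.ofReal_toReal hqt]
  rw [← ENNReal.ofReal_mul ENNReal.toReal_nonneg]
  nth_rw 2 [← ENNReal.ofReal_toReal hr]
  rw [← ENNReal.ofReal_add (Real.negMulLog_nonneg ENNReal.toReal_nonneg hq1)
      ENNReal.toReal_nonneg]
  refine (ENNReal.ofReal_le_ofReal ?_).trans ENNReal.ofReal_add_le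
  linarith [negMulLog_le_neg_mul_log_add_sub q.toReal_nonneg (ENNReal.toReal_pos hr0 hr)]

theorem entropy_eq_lintegral_infoContent (p : Measure ℕ+) [IsFiniteMeasure p] :
    entropy p = ∫⁻ x, infoContent (p {x}) ∂p := by
  rw [lintegral_countable', entropy]
  refine tsum_congr fun x => ?_
  rcases eq_or_ne (p {x}) 0 with h | h
  · simp [h, Measure.real]
  · rw [infoContent_of_ne_zero_of_ne_top h (measure_ne_top p _), mul_comm, Real.negMulLog,
      neg_mul_comm, ENNReal.ofReal_mul measureReal_nonneg, ofReal_measureReal, Measure.real]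

theorem tsum_measure_singleton {α : Type*} [MeasurableSpace α] [MeasurableSingletonClass α]
    [Countable α] (p : Measure α) : ∑' x, p {x} = p Set.univ := by
  simpa using p.tsum_indicator_apply_singleton Set.univ .univ

theorem entropy_le_lintegral_infoContent (q r : Measure ℕ+) [IsProbabilityMeasure q]
    (hr : r Set.univ ≤ 1) : entropy q ≤ ∫⁻ x, infoContent (r {x}) ∂q := by
  refine (ENNReal.add_le_add_iff_right ENNReal.one_ne_top).1 ?_
  calc entropy q + 1
      = ∑' x, (ENNReal.ofReal (Real.negMulLog (q.real {x})) + q {x}) := by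
        rw [ENNReal.tsum_add, tsum_measure_singleton, measure_univ, entropy]
    _ ≤ ∑' x, (q {x} * infoContent (r {x}) + r {x}) :=
        ENNReal.tsum_le_tsum fun x => ofReal_negMulLog_add_le prob_le_one
    _ = ∫⁻ x, infoContent (r {x}) ∂q + r Set.univ := by
        simp only [ENNReal.tsum_add, tsum_measure_singleton, lintegral_countable', mul_comm]
    _ ≤ ∫⁻ x, infoContent (r {x}) ∂q + 1 := by gcongr

end Gibbs

section ConditionalGibbs

variable {Ω 𝒴 : Type*} [MeasurableSpace Ω] [MeasurableSpace 𝒴] {P : Measure Ω} {Y : Ω → 𝒴}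

theorem lintegral_lintegral_condDistrib [IsFiniteMeasure P] {α : Type*} [MeasurableSpace α]
    [StandardBorelSpace α] [Nonempty α] {X : Ω → α} (hX : AEMeasurable X P)
    (hY : AEMeasurable Y P) {c : 𝒴 × α → ℝ≥0∞} (hc : Measurable c) :
    ∫⁻ ω, ∫⁻ x, c (Y ω, x) ∂condDistrib X Y P (Y ω) ∂P = ∫⁻ ω, c (Y ω, X ω) ∂P := by
  rw [← lintegral_map' hc.aemeasurable (hY.prodMk hX), ← compProd_map_condDistrib hX,
    Measure.lintegral_compProd hc,
    lintegral_map' hc.lintegral_kernel_prod_right'.aemeasurable hY]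

theorem condEntropy_le_lintegral_infoContent [IsProbabilityMeasure P] {X : Ω → ℕ+}
    (hX : AEMeasurable X P) (hY : AEMeasurable Y P) {r : 𝒴 → Measure ℕ+}
    (hr : ∀ x, Measurable fun y => r y {x}) (hr1 : ∀ y, r y Set.univ ≤ 1) :
    condEntropy P X Y ≤ ∫⁻ ω, infoContent (r (Y ω) {X ω}) ∂P := by
  have hc : Measurable fun z : 𝒴 × ℕ+ => infoContent (r z.1 {z.2}) :=
    measurable_from_prod_countable_left fun x => continuous_infoContent.measurable.comp (hr x)
  rw [← lintegral_lintegral_condDistrib hX hY hc]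
  exact lintegral_mono fun ω => entropy_le_lintegral_infoContent _ _ (hr1 (Y ω))

end ConditionalGibbs

/-- The mixture `(1 - η) U + η p`, where `U` gives mass `1 / L` to each point of the list `s`. When
`s` has at most `L` elements, this is a subprobability measure. It serves as the reference measure
in Gibbs' inequality. -/
noncomputable def listMixture (p : Measure ℕ+) (L : ℕ) (η : ℝ≥0∞) (s : Finset ℕ+) : Measure ℕ+ :=
  ((1 - η) / L) • Measure.count.restrict s + η • p

section ListMixture

variable {p : Measure ℕ+} {L : ℕ} {η : ℝ≥0∞} {s : Finset ℕ+} {x : ℕ+}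

theorem listMixture_univ_le_one [IsProbabilityMeasure p] (hη : η ≤ 1) (hs : s.card ≤ L) :
    listMixture p L η s Set.univ ≤ 1 :=
  calc listMixture p L η s Set.univ = (1 - η) / L * s.card + η := by
        simp [listMixture]
    _ ≤ L * ((1 - η) / L) + η := by rw [mul_comm]; gcongr
    _ ≤ (1 - η) + η := by gcongr; exact ENNReal.mul_div_le
    _ = 1 := tsub_add_cancel_of_le hη

theorem infoContent_listMixture_le_of_mem (hx : x ∈ s) :
    infoContent (listMixture p L η s {x}) ≤
      ENNReal.ofReal (Real.log L) + infoContent (1 - η) :=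
  calc infoContent (listMixture p L η s {x}) ≤ infoContent ((L : ℝ≥0∞)⁻¹ * (1 - η)) := by
        refine antitone_infoContent ?_
        simp [listMixture, hx, div_eq_mul_inv, mul_comm]
    _ ≤ ENNReal.ofReal (Real.log L) + infoContent (1 - η) := by
        rw [← infoContent_inv_natCast]
        exact infoContent_mul_le

theorem infoContent_listMixture_le :
    infoContent (listMixture p L η s {x}) ≤ infoContent η + infoContent (p {x}) :=
  (antitone_infoContent (by simp [listMixture])).trans infoContent_mul_le

theorem measurable_listMixture_singleton {𝒴 : Type*} [MeasurableSpace 𝒴] {f : 𝒴 → Finset ℕ+}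
    (hf : MeasurableSet {y | x ∈ f y}) : Measurable fun y => listMixture p L η (f y) {x} := by
  have h (y : 𝒴) : listMixture p L η (f y) {x} =
      (1 - η) / L * {y | x ∈ f y}.indicator 1 y + η * p {x} := by
    by_cases hx : x ∈ f y <;> simp [listMixture, hx]
  simp only [h]
  exact ((measurable_one.indicator hf).const_mul _).add_const _

end ListMixture

section ListError

variable {Ω 𝒴 : Type*} [MeasurableSpace Ω] [MeasurableSpace 𝒴] {P : Measure Ω} {X : Ω → ℕ+}
  {Y : Ω → 𝒴} {L : ℕ}

theorem IsListDecoder.measurableSet_error {f : 𝒴 → Finset ℕ+} (hf : IsListDecoder L f)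
    (hX : Measurable X) (hY : Measurable Y) : MeasurableSet {ω | X ω ∉ f (Y ω)} := by
  have h : {ω | X ω ∉ f (Y ω)} = ⋃ x : ℕ+, X ⁻¹' {x} ∩ (Y ⁻¹' {y | x ∈ f y})ᶜ := by
    ext ω; simp
  rw [h]
  exact .iUnion fun x => (hX (measurableSet_singleton x)).inter (hY (hf.2 x)).compl

theorem le_add_mul_listError {C A K : ℝ≥0∞} (hK : K ≠ 0) (hK' : K ≠ ⊤)
    (h : ∀ f : 𝒴 → Finset ℕ+, IsListDecoder L f → C ≤ A + K * P {ω | X ω ∉ f (Y ω)}) :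
    C ≤ A + K * listError P L X Y := by
  rw [← tsub_le_iff_left, ← ENNReal.div_le_iff' hK hK']
  refine le_iInf₂ fun f hf => ?_
  rw [ENNReal.div_le_iff' hK hK', tsub_le_iff_left]
  exact h f hf

end ListError

section FanoInequality

variable {Ω 𝒴 : Type*} [MeasurableSpace Ω] [MeasurableSpace 𝒴] {P : Measure Ω}
  [IsProbabilityMeasure P] {X : Ω → ℕ+} {Y : Ω → 𝒴} {L : ℕ} {f : 𝒴 → Finset ℕ+} {η : ℝ≥0∞}

theorem IsListDecoder.condEntropy_le (hf : IsListDecoder L f) (hX : AEMeasurable X P)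
    (hY : AEMeasurable Y P) (hη : η ≤ 1) :
    condEntropy P X Y ≤ ENNReal.ofReal (Real.log L) + infoContent (1 - η) +
      (infoContent η * P {ω | X ω ∉ f (Y ω)} +
        ∫⁻ ω in {ω | X ω ∉ f (Y ω)}, infoContent (P.map X {X ω}) ∂P) := by
  have := Measure.isProbabilityMeasure_map hX
  set E := {ω | X ω ∉ f (Y ω)}
  calc condEntropy P X Y
      ≤ ∫⁻ ω, infoContent (listMixture (P.map X) L η (f (Y ω)) {X ω}) ∂P :=
        condEntropy_le_lintegral_infoContent (r := fun y => listMixture _ L η (f y)) hX hY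
          (fun x => measurable_listMixture_singleton (hf.2 x))
          (fun y => listMixture_univ_le_one hη (hf.1 y).2)
    _ ≤ ∫⁻ ω, (ENNReal.ofReal (Real.log L) + infoContent (1 - η)) +
          E.indicator (fun ω => infoContent η + infoContent (P.map X {X ω})) ω ∂P := by
        refine lintegral_mono fun ω => ?_
        by_cases hω : X ω ∈ f (Y ω)
        · exact (infoContent_listMixture_le_of_mem hω).trans le_self_add
        · rw [Set.indicator_of_mem hω]
          exact infoContent_listMixture_le.trans le_add_self
    _ = ENNReal.ofReal (Real.log L) + infoContent (1 - η) +
          ∫⁻ ω, E.indicator (fun ω => infoContent η + infoContent (P.map X {X ω})) ω ∂P := by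
        rw [lintegral_add_left measurable_const, lintegral_const, measure_univ, mul_one]
    _ ≤ ENNReal.ofReal (Real.log L) + infoContent (1 - η) +
          ∫⁻ ω in E, (infoContent η + infoContent (P.map X {X ω})) ∂P :=
        add_le_add_right (lintegral_indicator_le _ _) _
    _ = ENNReal.ofReal (Real.log L) + infoContent (1 - η) +
          (infoContent η * P E + ∫⁻ ω in E, infoContent (P.map X {X ω}) ∂P) := by
        rw [lintegral_add_left measurable_const, setLIntegral_const]

theorem rvEntropy_eq_lintegral_infoContent (hX : AEMeasurable X P) :
    rvEntropy P X = ∫⁻ ω, infoContent (P.map X {X ω}) ∂P := by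
  rw [rvEntropy, entropy_eq_lintegral_infoContent,
    lintegral_map' (Measurable.of_discrete).aemeasurable hX]

theorem condEntropy_sub_log_le (hX : Measurable X) (hY : Measurable Y) (hη0 : η ≠ 0)
    (hη1 : η < 1) {δ : ℝ≥0∞} (hδ : δ ≠ 0) :
    condEntropy P X Y - ENNReal.ofReal (Real.log L) ≤
      infoContent (1 - η) + infoContent η * listError P L X Y +
        (δ + (listError P L X Y +
          P {ω | infoContent (P.map X {X ω}) ≤ (1 - δ) * rvEntropy P X})) * rvEntropy P X := by
  have hH := rvEntropy_eq_lintegral_infoContent (P := P) hX.aemeasurable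
  set H := rvEntropy P X
  set B := {ω | infoContent (P.map X {X ω}) ≤ (1 - δ) * H}
  rcases eq_or_ne H ⊤ with htop | htop
  · simp [htop, hδ]
  have hdecoder (f : 𝒴 → Finset ℕ+) (hf : IsListDecoder L f) :
      condEntropy P X Y ≤ ENNReal.ofReal (Real.log L) + infoContent (1 - η) + (δ + P B) * H +
        (infoContent η + H) * P {ω | X ω ∉ f (Y ω)} := by
    have hinfo : Measurable fun ω => infoContent (P.map X {X ω}) :=
      (Measurable.of_discrete (f := fun x => infoContent (P.map X {x}))).comp hX
    have htail := setLIntegral_le_add_measure_mul_lintegral (P := P) hinfo.aemeasurable δ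
      (hf.measurableSet_error hX hY)
    rw [← hH] at htail
    refine (hf.condEntropy_le hX.aemeasurable hY.aemeasurable hη1.le).trans
      ((add_le_add_right (add_le_add_right htail _) _).trans_eq ?_)
    ring
  have hK : infoContent η + H ≠ 0 := by simp [infoContent_eq_zero_iff, hη1.not_ge]
  have hK' : infoContent η + H ≠ ⊤ := by simp [infoContent_eq_top_iff, hη0, htop]
  rw [tsub_le_iff_left]
  refine (le_add_mul_listError hK hK' hdecoder).trans_eq ?_
  ring

end FanoInequality

section Asymptotics

theorem IsLittleOh.add {a b h : ℕ → ℝ≥0∞} (ha : IsLittleOh a h) (hb : IsLittleOh b h) :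
    IsLittleOh (fun n => a n + b n) h := by
  intro c hc
  filter_upwards [ha (c / 2) (half_pos hc), hb (c / 2) (half_pos hc)] with n han hbn
  calc a n + b n ≤ (c / 2 : ℝ≥0) * h n + (c / 2 : ℝ≥0) * h n := add_le_add han hbn
    _ = c * h n := by rw [← add_mul, ← ENNReal.coe_add, add_halves]

theorem IsLittleOh.mono {a b h : ℕ → ℝ≥0∞} (hb : IsLittleOh b h) (hab : ∀ n, a n ≤ b n) :
    IsLittleOh a h := fun c hc => (hb c hc).mono fun n => (hab n).trans

variable {Ω 𝒴 : ℕ → Type*} [∀ n, MeasurableSpace (Ω n)] [∀ n, MeasurableSpace (𝒴 n)]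
  {P : ∀ n, Measure (Ω n)} [∀ n, IsProbabilityMeasure (P n)]
  {X : ∀ n, Ω n → ℕ+} {Y : ∀ n, Ω n → 𝒴 n} {L : ℕ → ℕ}

theorem SatisfiesAEP.tendsto_measure_infoContent_le (hAEP : SatisfiesAEP P X)
    (hX : ∀ n, AEMeasurable (X n) (P n)) {δ : ℝ≥0} (hδ : 0 < δ) :
    Tendsto (fun n => P n {ω | infoContent ((P n).map (X n) {X n ω}) ≤
      (1 - δ) * rvEntropy (P n) (X n)}) atTop (𝓝 0) := by
  -- `1 - δ` is truncated in `ℝ≥0∞` but not in `SatisfiesAEP`; replacing `δ` by `min 1 δ` makes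
  -- the two agree.
  refine tendsto_of_tendsto_of_tendsto_of_le_of_le tendsto_const_nhds
    (hAEP (min 1 δ : ℝ≥0) (by positivity)) (fun _ => zero_le)
    fun n => measure_mono fun ω hω => ?_
  have := Measure.isProbabilityMeasure_map (hX n)
  have hcoe : ((1 - (min 1 δ : ℝ≥0) : ℝ) : EReal) = ((1 - δ : ℝ≥0∞) : EReal) := by
    rw [← NNReal.coe_one, ← NNReal.coe_sub (min_le_left _ _), tsub_min]
    rfl
  rw [Set.mem_ofPred_eq, ← coe_infoContent prob_le_one, hcoe, ← EReal.coe_ennreal_mul]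
  exact EReal.coe_ennreal_le_coe_ennreal_iff.2 hω

theorem isLittleOh_condEntropy_sub_log (hX : ∀ n, Measurable (X n)) (hY : ∀ n, Measurable (Y n))
    (hAEP : SatisfiesAEP P X) (hH : IsOmegaOne fun n => rvEntropy (P n) (X n))
    (herr : Tendsto (fun n => listError (P n) (L n) (X n) (Y n)) atTop (𝓝 0)) :
    IsLittleOh (fun n => condEntropy (P n) (X n) (Y n) - ENNReal.ofReal (Real.log (L n)))
      (fun n => rvEntropy (P n) (X n)) := by
  intro c hc
  obtain ⟨b, hb, hbH⟩ := hH
  obtain ⟨δ, hδ, rfl⟩ : ∃ δ : ℝ≥0, 0 < δ ∧ c = 4 * δ :=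
    ⟨c / 4, by positivity, (mul_div_cancel₀ c four_ne_zero).symm⟩
  have hδb : (0 : ℝ≥0∞) < δ * b := by exact_mod_cast mul_pos hδ hb
  obtain ⟨η, hη0, hη1, hη⟩ := exists_infoContent_one_sub_lt hδb.ne'
  have hcost : ∀ᶠ n in atTop, infoContent η * listError (P n) (L n) (X n) (Y n) < δ * b := by
    have h := ENNReal.Tendsto.const_mul herr (.inr (infoContent_eq_top_iff.not.2 hη0.ne'))
    rw [mul_zero] at h
    exact h.eventually_lt_const hδb
  have hprob := herr.add (hAEP.tendsto_measure_infoContent_le (fun n => (hX n).aemeasurable) hδ)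
  rw [add_zero] at hprob
  filter_upwards [hbH, hcost, hprob.eventually_lt_const (ENNReal.coe_pos.2 hδ)]
    with n hbn hcostn hprobn
  set H := rvEntropy (P n) (X n)
  calc condEntropy (P n) (X n) (Y n) - ENNReal.ofReal (Real.log (L n))
      ≤ _ := condEntropy_sub_log_le (hX n) (hY n) hη0.ne' hη1 (ENNReal.coe_ne_zero.2 hδ.ne')
    _ ≤ δ * b + δ * b + (δ + δ) * H := by gcongr
    _ ≤ δ * H + δ * H + (δ + δ) * H := by gcongr
    _ = (4 * δ : ℝ≥0) * H := by push_cast; ring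

end Asymptotics

end ListFano

/- Subtraction on `ℝ≥0∞` is truncated at `0`, so `H(Xₙ | Yₙ) - log Lₙ` below is the positive part
`|H(Xₙ | Yₙ) - log Lₙ|⁺`. -/
theorem theorem3 {Ω : ℕ → Type*} {𝒴 : ℕ → Type*}
    [∀ n, MeasurableSpace (Ω n)] [∀ n, MeasurableSpace (𝒴 n)]
    (P : ∀ n, Measure (Ω n)) [∀ n, IsProbabilityMeasure (P n)]
    (X : ∀ n, Ω n → ℕ+) (hX : ∀ n, Measurable (X n))
    (Y : ∀ n, Ω n → 𝒴 n) (hY : ∀ n, Measurable (Y n))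
    (L : ℕ → ℕ) (hL : ∀ n, 1 ≤ L n)
    (hAEP : ListFano.SatisfiesAEP P X)
    (hH : ListFano.IsOmegaOne (fun n => ListFano.rvEntropy (P n) (X n))) :
    (Tendsto (fun n => ListFano.listError (P n) (L n) (X n) (Y n)) atTop (𝓝 0) →
      ListFano.IsLittleOh
        (fun n => ListFano.condEntropy (P n) (X n) (Y n) - ENNReal.ofReal (Real.log (L n)))
        (fun n => ListFano.rvEntropy (P n) (X n))) ∧
    (Tendsto (fun n => ListFano.listError (P n) (L n) (X n) (Y n)) atTop (𝓝 0) ∧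
      ListFano.IsLittleOh (fun n => ENNReal.ofReal (Real.log (L n)))
        (fun n => ListFano.rvEntropy (P n) (X n)) →
      ListFano.IsLittleOh (fun n => ListFano.condEntropy (P n) (X n) (Y n))
        (fun n => ListFano.rvEntropy (P n) (X n))) := by
  have h := ListFano.isLittleOh_condEntropy_sub_log (L := L) hX hY hAEP hH
  exact ⟨h, fun ⟨herr, hlog⟩ => ((h herr).add hlog).mono fun _ => le_tsub_add⟩
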